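/- Let $n,p\ge 0$ be integers and let $\|\cdot\|$ be a norm on $\mathbb{R}^p$ whose unit ball $B=\{x\in\mathbb{R}^p:\|x\|\le 1\}$ is a polytope, i.e. the convex hull of a finite set of points. For $X\in\mathbb{R}^{n\times p}$ and $y\in\mathbb{R}^n$ let $$S_{X,\|\cdot\|}(y)=\operatorname*{arg\,min}_{b\in\mathbb{R}^p}\ \tfrac12\|y-Xb\|_2^2+\|b\|$$ be the set of all minimizers of the penalized least-squares problem, where $\|\cdot\|_2$ is the Euclidean norm on $\mathbb{R}^n$, and let $\mu$ be the Lebesgue measure on $\mathbb{R}^{n\times p}$. Then $$\mu\left(\left\{X\in\mathbb{R}^{n\times p}:\ \exists\, y\in\mathbb{R}^n\text{ with }|S_{X,\|\cdot\|}(y)|>1\right\}\right)=0.$$ -/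

import Mathlib

open MeasureTheory

/-- A polytope: the convex hull of a finite set of points of `ℝᵖ`. -/
def IsPolytope {p : ℕ} (P : Set (Fin p → ℝ)) : Prop :=
  ∃ V : Set (Fin p → ℝ), V.Finite ∧ P = convexHull ℝ V

/-- The unit ball `{x : ‖x‖ ≤ 1}` of a (semi)norm `N` on `ℝᵖ`. -/
def unitBall {p : ℕ} (N : Seminorm ℝ (Fin p → ℝ)) : Set (Fin p → ℝ) :=
  {x | N x ≤ 1}

/-- The penalized least-squares objective `½ ‖y - X b‖₂² + N b`, where `‖·‖₂` is the Euclidean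
norm on `ℝⁿ`. -/
noncomputable def penalizedObjective {n p : ℕ} (X : Matrix (Fin n) (Fin p) ℝ)
    (N : Seminorm ℝ (Fin p → ℝ)) (y : Fin n → ℝ) (b : Fin p → ℝ) : ℝ :=
  1 / 2 * ‖WithLp.toLp 2 (y - X.mulVec b)‖ ^ 2 + N b

/-- The solution set: all global minimizers over `ℝᵖ` of the penalized least-squares objective. -/
def penalizedSolutions {n p : ℕ} (X : Matrix (Fin n) (Fin p) ℝ)
    (N : Seminorm ℝ (Fin p → ℝ)) (y : Fin n → ℝ) : Set (Fin p → ℝ) :=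
  {b | IsMinOn (penalizedObjective X N y) Set.univ b}

/-!
Let `b₁ ≠ b₂` minimize `½ ‖y - X b‖² + N b`.  First-order optimality and strict convexity of the
Euclidean square give `X b₁ = X b₂` and `N b₁ = N b₂ > 0`; moreover, with `r = y - X b₁`, the
functional `s b = r ⬝ X b` satisfies `s ≤ N` everywhere and `s bᵢ = N bᵢ`
(`penalizedSolutions_pair`).  After scaling to norm one, both minimizers lie in the face of the
unit ball exposed by `s = 1`, which is the convex hull of the set `F` of those `v` with `s v = 1`
among the finitely many points that generate the ball (`mem_convexHull_face`).  Hence `b₁ - b₂` is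
a nonzero vector of the direction `D` of that face, and `s` vanishes on `D`.

Now `X` fails to be injective on `D`, as `X b₁ = X b₂`.  It fails to map `D` onto `ℝⁿ` too: `r` is
orthogonal to `X D`, and `r ≠ 0` because `r ⬝ X b₁ = N b₁ > 0`.  So `X` restricted to `D` does
not have full rank.  For a fixed `D` this happens only for a null set of matrices
(`ae_injective_or_surjective_domRestrict`), and only finitely many `D` arise, one for each set of
generating points.

The null set is found by slicing: a suitable square submatrix of `X` on `D` changes to `A + t • 1`
when `X` moves along a well-chosen line, and this is singular only when `-t` is an eigenvalue
of `A`.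
-/

open Matrix

/-! ### Matrices have full rank on a given subspace almost everywhere -/

/-- For fixed linearly independent vectors `wᵢ`, the matrix of selected coordinates of the `X wᵢ`
is invertible for almost every `X`. -/
lemma ae_det_mulVec_ne_zero {n p m : ℕ} (w : Fin m → Fin p → ℝ) (hw : LinearIndependent ℝ w)
    (e : Fin m → Fin n) (he : Function.Injective e) :
    ∀ᵐ X : Fin n → Fin p → ℝ,
      (Matrix.of fun i j => (Matrix.of X *ᵥ w i) (e j)).det ≠ 0 := by
  -- `M` sends `w i` to the basis vector `e i`, so that moving along `M` adds a multiple of `1`.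
  obtain ⟨M, hM⟩ : ∃ M : Matrix (Fin n) (Fin p) ℝ, ∀ i, M *ᵥ w i = Pi.single (e i) 1 := by
    obtain ⟨g, hg⟩ := (Fintype.linearCombination ℝ w).exists_leftInverse_of_injective
      (LinearMap.ker_eq_bot.2 hw.fintypeLinearCombination_injective)
    refine ⟨LinearMap.toMatrix'
      ((Fintype.linearCombination ℝ fun i => (Pi.single (e i) 1 : Fin n → ℝ)) ∘ₗ g), fun i => ?_⟩
    have hgi : g (w i) = Pi.single i 1 := by
      simpa [Fintype.linearCombination_apply_single] using
        LinearMap.congr_fun hg (Pi.single i (1 : ℝ))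
    rw [← Matrix.toLin'_apply, Matrix.toLin'_toMatrix', LinearMap.comp_apply, hgi,
      Fintype.linearCombination_apply_single, one_smul]
  have hmeas : MeasurableSet {X : Fin n → Fin p → ℝ |
      (Matrix.of fun i j => (Matrix.of X *ᵥ w i) (e j)).det ≠ 0} := by
    refine (isOpen_ne_fun (Continuous.matrix_det ?_) continuous_const).measurableSet
    refine continuous_matrix fun i j => ?_
    simp only [Matrix.of_apply, Matrix.mulVec, dotProduct]
    fun_prop
  refine ae_mem_of_ae_add_linearMap_mem
    (LinearMap.toSpanSingleton ℝ (Fin n → Fin p → ℝ) M) volume volume hmeas fun X => ?_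
  set A : Matrix (Fin m) (Fin m) ℝ := Matrix.of fun i j => (Matrix.of X *ᵥ w i) (e j) with hA
  have hne : (-A).charpoly ≠ 0 := (Matrix.charpoly_monic _).ne_zero
  have hfin : {t : ℝ | (-A).charpoly.IsRoot t}.Finite := Polynomial.finite_setOfPred_isRoot hne
  filter_upwards [compl_mem_ae_iff.2 (hfin.measure_zero volume)] with t ht h0
  refine ht ?_
  rw [Set.mem_ofPred_eq, Polynomial.IsRoot.def, Matrix.eval_charpoly, ← h0]
  congr 1
  ext i j
  have hsum : Matrix.of (X + (LinearMap.toSpanSingleton ℝ (Fin n → Fin p → ℝ) M) t) *ᵥ w i =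
      Matrix.of X *ᵥ w i + t • (M *ᵥ w i) := by
    change (Matrix.of X + t • M) *ᵥ w i = _
    rw [Matrix.add_mulVec, Matrix.smul_mulVec]
  rw [Matrix.of_apply, hsum, hM]
  by_cases hij : i = j
  · subst hij
    simp [hA, add_comm]
  · simp [hA, hij, he.ne (Ne.symm hij)]

lemma ae_injective_or_surjective_domRestrict {n p : ℕ} (D : Submodule ℝ (Fin p → ℝ)) :
    ∀ᵐ X : Fin n → Fin p → ℝ,
      Function.Injective ((Matrix.of X).mulVecLin.domRestrict D) ∨
        Function.Surjective ((Matrix.of X).mulVecLin.domRestrict D) := by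
  obtain ⟨w, hw⟩ := exists_linearIndependent_of_le_finrank (R := ℝ) (M := D)
    (min_le_right n (Module.finrank ℝ D))
  have hw' : LinearIndependent ℝ fun i => (w i : Fin p → ℝ) :=
    hw.map' D.subtype D.ker_subtype
  filter_upwards [ae_det_mulVec_ne_zero _ hw' (Fin.castLE (min_le_left n (Module.finrank ℝ D)))
    (Fin.castLE_injective _)] with X hX
  set T := (Matrix.of X).mulVecLin.domRestrict D
  have hli : LinearIndependent ℝ fun i => T (w i) := by
    refine LinearIndependent.of_comp
      (LinearMap.funLeft ℝ ℝ (Fin.castLE (min_le_left n (Module.finrank ℝ D)))) ?_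
    exact Matrix.linearIndependent_rows_of_det_ne_zero hX
  have hrank : min n (Module.finrank ℝ D) ≤ Module.finrank ℝ (LinearMap.range T) := by
    have hli' : LinearIndependent ℝ fun i => (⟨T (w i), w i, rfl⟩ : LinearMap.range T) :=
      LinearIndependent.of_comp (LinearMap.range T).subtype hli
    simpa using hli'.fintype_card_le_finrank
  rcases min_le_iff.1 hrank with h | h
  · right
    rw [← LinearMap.range_eq_top]
    refine Submodule.eq_top_of_finrank_eq (le_antisymm (Submodule.finrank_le _) ?_)
    simpa using h
  · left
    rw [← LinearMap.ker_eq_bot, ← Submodule.finrank_eq_zero (R := ℝ)]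
    have := T.finrank_range_add_finrank_ker
    omega

/-! ### Exposed faces of a polytope -/

lemma mem_convexHull_face {E : Type*} [AddCommGroup E] [Module ℝ E] {V : Set E} (hV : V.Finite)
    (s : E →ₗ[ℝ] ℝ) (hs : ∀ v ∈ V, s v ≤ 1) {x : E} (hx : x ∈ convexHull ℝ V) (hsx : s x = 1) :
    x ∈ convexHull ℝ {v ∈ V | s v = 1} := by
  lift V to Finset E using hV
  obtain ⟨c, hc0, hc1, rfl⟩ := Finset.mem_convexHull'.1 hx
  -- A convex combination of values `≤ 1` is `1` only if the points with `s v < 1` have weight `0`.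
  have hzero : ∀ v ∈ V, c v * (1 - s v) = 0 := by
    refine (Finset.sum_eq_zero_iff_of_nonneg fun v hv =>
      mul_nonneg (hc0 v hv) (sub_nonneg.2 (hs v hv))).1 ?_
    simp only [map_sum, map_smul, smul_eq_mul] at hsx
    simp [mul_sub, Finset.sum_sub_distrib, hc1, hsx]
  classical
  have hoff : ∀ v ∈ V, c v ≠ 0 → s v = 1 := fun v hv h => by
    rcases mul_eq_zero.1 (hzero v hv) with h' | h'
    · exact absurd h' h
    · linarith
  rw [← Finset.sum_filter_of_ne (p := fun v => s v = 1)
    fun v hv h => hoff v hv fun h0 => h (by rw [h0, zero_smul])]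
  refine (convex_convexHull ℝ _).sum_mem (fun v hv => hc0 v (Finset.mem_filter.1 hv).1) ?_
    fun v hv => subset_convexHull ℝ _ (by simpa using hv)
  rw [Finset.sum_filter_of_ne fun v hv h => hoff v hv h, hc1]

lemma map_eq_zero_of_mem_vectorSpan {E : Type*} [AddCommGroup E] [Module ℝ E] {F : Set E}
    (s : E →ₗ[ℝ] ℝ) {a : ℝ} (hs : ∀ v ∈ F, s v = a) {d : E} (hd : d ∈ vectorSpan ℝ F) :
    s d = 0 := by
  suffices vectorSpan ℝ F ≤ LinearMap.ker s from this hd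
  refine Submodule.span_le.2 ?_
  rintro _ ⟨u, hu, v, hv, rfl⟩
  simp [hs u hu, hs v hv]

/-! ### First-order optimality -/

lemma penalizedObjective_eq {n p : ℕ} (X : Matrix (Fin n) (Fin p) ℝ)
    (N : Seminorm ℝ (Fin p → ℝ)) (y : Fin n → ℝ) (b : Fin p → ℝ) :
    penalizedObjective X N y b = 1 / 2 * ((y - X *ᵥ b) ⬝ᵥ (y - X *ᵥ b)) + N b := by
  rw [penalizedObjective, EuclideanSpace.real_norm_sq_eq]
  simp [dotProduct, sq]

/-- Expansion of the objective around `b` in the direction `d`. -/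
lemma penalizedObjective_add {n p : ℕ} (X : Matrix (Fin n) (Fin p) ℝ)
    (N : Seminorm ℝ (Fin p → ℝ)) (y : Fin n → ℝ) (b d : Fin p → ℝ) :
    penalizedObjective X N y (b + d) = penalizedObjective X N y b + (N (b + d) - N b)
      - (y - X *ᵥ b) ⬝ᵥ (X *ᵥ d) + 1 / 2 * ((X *ᵥ d) ⬝ᵥ (X *ᵥ d)) := by
  have h : y - X *ᵥ (b + d) = (y - X *ᵥ b) - X *ᵥ d := by rw [Matrix.mulVec_add]; abel
  rw [penalizedObjective_eq, penalizedObjective_eq, h]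
  generalize y - X *ᵥ b = r
  rw [sub_dotProduct, dotProduct_sub, dotProduct_sub, dotProduct_comm (X *ᵥ d) r]
  ring

/-- The vector `Xᵀ (y - X b)` is a subgradient of `N` at a minimizer `b`. -/
lemma subgradient_of_mem_penalizedSolutions {n p : ℕ} {X : Matrix (Fin n) (Fin p) ℝ}
    {N : Seminorm ℝ (Fin p → ℝ)} {y : Fin n → ℝ} {b : Fin p → ℝ}
    (hb : b ∈ penalizedSolutions X N y) (d : Fin p → ℝ) :
    (y - X *ᵥ b) ⬝ᵥ (X *ᵥ d) ≤ N (b + d) - N b := by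
  set q := (X *ᵥ d) ⬝ᵥ (X *ᵥ d) with hq
  -- Compare `b` with `b + t • d` for small `t`, using convexity of `N` on the segment.
  have key : ∀ t ∈ Set.Ioo (0 : ℝ) 1,
      (y - X *ᵥ b) ⬝ᵥ (X *ᵥ d) ≤ N (b + d) - N b + t * (1 / 2 * q) := by
    rintro t ⟨ht0, ht1⟩
    have hmin : penalizedObjective X N y b ≤ penalizedObjective X N y (b + t • d) :=
      hb (Set.mem_univ _)
    rw [penalizedObjective_add, Matrix.mulVec_smul, dotProduct_smul, dotProduct_smul,
      smul_dotProduct, smul_eq_mul, smul_eq_mul, smul_eq_mul, ← hq] at hmin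
    have hconv : N (b + t • d) ≤ (1 - t) * N b + t * N (b + d) := by
      have h := map_add_le_add N ((1 - t) • b) (t • (b + d))
      rw [map_smul_eq_mul, map_smul_eq_mul, Real.norm_of_nonneg ht0.le,
        Real.norm_of_nonneg (sub_nonneg.2 ht1.le)] at h
      rwa [show (1 - t) • b + t • (b + d) = b + t • d by module] at h
    refine le_of_mul_le_mul_left ?_ ht0
    linarith
  have hlim : Filter.Tendsto (fun t : ℝ => N (b + d) - N b + t * (1 / 2 * q))
      (nhdsWithin 0 (Set.Ioi 0)) (nhds (N (b + d) - N b)) := by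
    have hc : Continuous fun t : ℝ => N (b + d) - N b + t * (1 / 2 * q) := by fun_prop
    simpa using (hc.tendsto 0).mono_left nhdsWithin_le_nhds
  exact ge_of_tendsto hlim
    (Filter.eventually_of_mem (Ioo_mem_nhdsGT one_pos) key)

/-- Two minimizers have the same fitted value and the same penalty, and the residual defines a
functional dominated by `N` that attains `N` at both of them. -/
lemma penalizedSolutions_pair {n p : ℕ} {X : Matrix (Fin n) (Fin p) ℝ}
    {N : Seminorm ℝ (Fin p → ℝ)} {y : Fin n → ℝ} {b₁ b₂ : Fin p → ℝ}
    (h₁ : b₁ ∈ penalizedSolutions X N y) (h₂ : b₂ ∈ penalizedSolutions X N y) :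
    X *ᵥ b₁ = X *ᵥ b₂ ∧ N b₁ = N b₂ ∧
      (∀ x, (y - X *ᵥ b₁) ⬝ᵥ (X *ᵥ x) ≤ N x) ∧ (y - X *ᵥ b₁) ⬝ᵥ (X *ᵥ b₁) = N b₁ := by
  have hsub := subgradient_of_mem_penalizedSolutions h₁
  have heq : penalizedObjective X N y b₁ = penalizedObjective X N y b₂ :=
    le_antisymm (h₁ (Set.mem_univ _)) (h₂ (Set.mem_univ _))
  have hX : X *ᵥ (b₂ - b₁) = 0 := by
    have hexp := penalizedObjective_add X N y b₁ (b₂ - b₁)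
    have hle := hsub (b₂ - b₁)
    rw [add_sub_cancel] at hexp hle
    refine dotProduct_self_eq_zero.1 (le_antisymm ?_ (Finset.sum_nonneg fun i _ => mul_self_nonneg _))
    linarith
  have hX' : X *ᵥ b₁ = X *ᵥ b₂ := by
    rw [Matrix.mulVec_sub, sub_eq_zero] at hX
    exact hX.symm
  have hval : (y - X *ᵥ b₁) ⬝ᵥ (X *ᵥ b₁) = N b₁ := by
    -- The directions `b₁` and `-b₁` give the two inequalities.
    have hu := hsub b₁
    have hl := hsub (-b₁)
    rw [Matrix.mulVec_neg, dotProduct_neg, add_neg_cancel, map_zero] at hl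
    rw [← two_smul ℝ b₁, map_smul_eq_mul, Real.norm_of_nonneg zero_le_two] at hu
    linarith
  refine ⟨hX', ?_, fun x => ?_, hval⟩
  · rw [penalizedObjective_eq, penalizedObjective_eq, hX'] at heq
    linarith
  · have h := hsub (x - b₁)
    rw [Matrix.mulVec_sub, dotProduct_sub, add_sub_cancel] at h
    linarith

/-! ### Uniqueness of minimizers for almost every matrix -/

/-- If `X` has full rank on the direction of the convex hull of every subset of a finite set
that generates the unit ball, then the minimizer is unique. -/
lemma penalizedSolutions_subsingleton {n p : ℕ} {N : Seminorm ℝ (Fin p → ℝ)}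
    (hN : ∀ x : Fin p → ℝ, N x = 0 → x = 0) {V : Set (Fin p → ℝ)} (hV : V.Finite)
    (hB : unitBall N = convexHull ℝ V) {X : Matrix (Fin n) (Fin p) ℝ}
    (hX : ∀ F ⊆ V, Function.Injective (X.mulVecLin.domRestrict (vectorSpan ℝ F)) ∨
      Function.Surjective (X.mulVecLin.domRestrict (vectorSpan ℝ F)))
    (y : Fin n → ℝ) : (penalizedSolutions X N y).Subsingleton := by
  intro b₁ h₁ b₂ h₂
  obtain ⟨hXb, hNb, hle, hval⟩ := penalizedSolutions_pair h₁ h₂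
  set r := y - X *ᵥ b₁
  by_cases h0 : N b₁ = 0
  · rw [hN b₁ h0, hN b₂ (hNb ▸ h0)]
  let s : (Fin p → ℝ) →ₗ[ℝ] ℝ := dotProductBilin ℝ ℝ r ∘ₗ X.mulVecLin
  have hs : ∀ x, s x = r ⬝ᵥ (X *ᵥ x) := fun x => rfl
  have hsV : ∀ v ∈ V, s v ≤ 1 := fun v hv => by
    have hv1 : v ∈ unitBall N := hB ▸ subset_convexHull ℝ V hv
    exact (hle v).trans hv1
  have hface : ∀ b, N b = N b₁ → s b = N b₁ →
      (N b₁)⁻¹ • b ∈ convexHull ℝ {v ∈ V | s v = 1} := fun b hb hsb => by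
    refine mem_convexHull_face hV s hsV ?_ ?_
    · rw [← hB]
      change N _ ≤ 1
      rw [map_smul_eq_mul, hb, norm_inv, Real.norm_of_nonneg (apply_nonneg N b₁),
        inv_mul_cancel₀ h0]
    · rw [map_smul, hsb, smul_eq_mul, inv_mul_cancel₀ h0]
  have hf₁ := hface b₁ rfl hval
  have hf₂ := hface b₂ hNb.symm (by rw [hs, ← hXb]; exact hval)
  set F := {v ∈ V | s v = 1}
  have hd : (N b₁)⁻¹ • b₁ - (N b₁)⁻¹ • b₂ ∈ vectorSpan ℝ F :=
    vsub_mem_vectorSpan_of_mem_affineSpan_of_mem_affineSpan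
      (convexHull_subset_affineSpan F hf₁) (convexHull_subset_affineSpan F hf₂)
  rw [← smul_sub, Submodule.smul_mem_iff _ (inv_ne_zero h0)] at hd
  rcases hX F (Set.sep_subset _ _) with hinj | hsurj
  · have hz : (⟨b₁ - b₂, hd⟩ : vectorSpan ℝ F) = 0 := by
      apply hinj
      rw [map_zero]
      simp [LinearMap.domRestrict_apply, Matrix.mulVec_sub, hXb]
    exact sub_eq_zero.1 (congrArg Subtype.val hz)
  · exfalso
    obtain ⟨d, hdr⟩ := hsurj r
    have hdr' : X *ᵥ (d : Fin p → ℝ) = r := hdr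
    have hr0 : r = 0 := by
      refine dotProduct_self_eq_zero.1 ?_
      have := map_eq_zero_of_mem_vectorSpan s (fun v (hv : v ∈ F) => hv.2) d.2
      rwa [hs, hdr'] at this
    exact h0 (by rw [← hval, hr0, zero_dotProduct])

/-- `volume` on `Fin n → Fin p → ℝ` is Lebesgue measure on `ℝⁿˣᵖ`, a matrix being given by its
entries; a norm is a seminorm that vanishes only at zero. -/
theorem mainTheorem6 (n p : ℕ) (N : Seminorm ℝ (Fin p → ℝ))
    (hN : ∀ x : Fin p → ℝ, N x = 0 → x = 0) (hB : IsPolytope (unitBall N)) :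
    (volume : Measure (Fin n → Fin p → ℝ))
      {X : Fin n → Fin p → ℝ |
        ∃ y : Fin n → ℝ, 1 < (penalizedSolutions (Matrix.of X) N y).encard} = 0 := by
  obtain ⟨V, hV, hB⟩ := hB
  have hae := (ae_ball_iff hV.finite_subsets.countable).2 fun F (_ : F ∈ {F | F ⊆ V}) =>
    ae_injective_or_surjective_domRestrict (n := n) (vectorSpan ℝ F)
  refine measure_mono_null ?_ (ae_iff.1 hae)
  rintro X ⟨y, hy⟩ hX
  exact hy.not_ge
    (Set.encard_le_one_iff_subsingleton.2 (penalizedSolutions_subsingleton hN hV hB hX y))
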